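/- Let $n$ be an integer, $\Delta_n = n^2+3n+9$, let $\rho_n \in \mathbb{C}$ be a root of Shanks' cubic polynomial $f_n(X) = X^3 - nX^2 - (n+3)X - 1$, and let $L_n = \mathbb{Q}(\rho_n)$ be the simplest cubic field. A normal integral basis of $L_n$ is a set of the form $\{\tau(\alpha) : \tau \in \mathrm{Gal}(L_n/\mathbb{Q})\}$ with $\alpha \in \mathcal{O}_{L_n}$ whose elements $\tau(\alpha)$ form a $\mathbb{Z}$-basis of the ring of integers $\mathcal{O}_{L_n}$. The group $\mathrm{Gal}(L_n/\mathbb{Q})$ is cyclic of order $3$ with a generator $\sigma$ satisfying $\sigma(\rho_n) = -1/(1+\rho_n)$; put $\rho_n^{(i)} = \sigma^i(\rho_n)$ for $i \in \mathbb{Z}/3\mathbb{Z}$. Then the following hold. (1) If $3 \nmid n$ and $\Delta_n$ is square-free, then the normal integral bases of $L_n$ are exactly $$\{v_n+\rho_n^{(0)},\ v_n+\rho_n^{(1)},\ v_n+\rho_n^{(2)}\} \quad\text{and}\quad \{-v_n-\rho_n^{(0)},\ -v_n-\rho_n^{(1)},\ -v_n-\rho_n^{(2)}\},$$ where $v_n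 = \frac{1}{3}\left(\left(\frac{n}{3}\right)-n\right)$ and $\left(\frac{n}{3}\right)$ is the Legendre symbol. (2) If $n \equiv 12 \pmod{27}$ and $\Delta_n/27$ (which is then an integer) is square-free, then the normal integral bases of $L_n$ are exactly $$\left\{\tfrac19(\rho_n^{(0)}-\rho_n^{(1)}+3),\ \tfrac19(\rho_n^{(1)}-\rho_n^{(2)}+3),\ \tfrac19(\rho_n^{(2)}-\rho_n^{(0)}+3)\right\}$$ and $$\left\{-\tfrac19(\rho_n^{(0)}-\rho_n^{(1)}+3),\ -\tfrac19(\rho_n^{(1)}-\rho_n^{(2)}+3),\ -\tfrac19(\rho_n^{(2)}-\rho_n^{(0)}+3)\right\}.$$ -/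

import Mathlib

open Polynomial
open scoped NumberField IntermediateField

/-- Shanks' cubic polynomial `X³ - n X² - (n + 3) X - 1`. -/
noncomputable def shanksPoly (n : ℤ) : ℤ[X] :=
  X ^ 3 - C n * X ^ 2 - C (n + 3) * X - 1

/-- `Δ_n = n² + 3n + 9`. -/
def shanksDelta (n : ℤ) : ℤ := n ^ 2 + 3 * n + 9

/-- The field `ℚ(ρ) ⊆ ℂ`; the simplest cubic field `L_n` when `ρ` is a root of `shanksPoly n`. -/
noncomputable abbrev simplestCubicField (ρ : ℂ) : IntermediateField ℚ ℂ := ℚ⟮ρ⟯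

/-- `ρ` regarded as an element of `ℚ(ρ)`. -/
noncomputable def rootElt (ρ : ℂ) : simplestCubicField ρ := IntermediateField.AdjoinSimple.gen ℚ ρ

/-- The conjugate `ρ^{(i)} = σ^i(ρ)`. -/
noncomputable def conjRoot {ρ : ℂ} (σ : simplestCubicField ρ ≃ₐ[ℚ] simplestCubicField ρ) (i : ℕ) :
    simplestCubicField ρ :=
  (σ ^ i) (rootElt ρ)

/-- The rational number `v_n = ((n/3) - n) / 3`, with `(n/3)` the Legendre symbol. -/
def shanksV (n : ℤ) : ℚ := ((legendreSym 3 n : ℚ) - n) / 3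

/-- `B` is a normal integral basis of `K`: for some `α ∈ 𝓞 K`, the conjugates `σ(α)`, `σ` running
through the automorphism group of `K` over `ℚ`, form a `ℤ`-basis of `𝓞 K`, and `B` is the set of
these conjugates. -/
def IsNormalIntegralBasis {K : Type*} [Field K] [Algebra ℚ K] (B : Set K) : Prop :=
  ∃ (α : 𝓞 K) (b : Module.Basis (K ≃ₐ[ℚ] K) ℤ (𝓞 K)),
    (∀ σ : K ≃ₐ[ℚ] K, (b σ : K) = σ (α : K)) ∧
      B = Set.range (fun σ : K ≃ₐ[ℚ] K => σ (α : K))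

/-! Let `σ` generate the Galois group of a cyclic cubic field `K`.

A normal integral basis is the set of conjugates of some `α`, a generator of the integers of `K` as
a module over `ℤ[C₃]`. Two generators differ by a unit of `ℤ[C₃]`, and these are the `±σⁱ` only
(`groupRing_cyclicThree_unit`). Hence as soon as one generator `α` is known, the normal integral
bases are the set of conjugates of `α` and its negative
(`GeneratesNormalBasis.setOf_isNormalIntegralBasis`).

It remains to show that the stated `α` is a generator. In both cases `α` has trace `t = ±1`, and
`Y = 3α - t` satisfies `Y² = 2m + hY + 3l σ(Y)` with `m = h² - 3hl + 9l²`, where `m` is `Δ_n` or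
`Δ_n / 27`, hence square-free and `≡ 1 (mod 3)`. It follows that `Y³ = 3mY + km` with `k = 2h - 3l`
prime to `m` (`circulant_sq_relations`, `isCoprime_of_squarefree_form`), which is of Eisenstein type
at every prime dividing `m`: an element of `ℤ[Y]` divisible by `m` among the algebraic integers is
divisible by `m` in `ℤ[Y]` (`dvd_coeff_of_eisenstein`). The lattice spanned by the conjugates of
`α` has discriminant `m²`, so that only primes dividing `m` can divide its index, and these are
excluded by the Eisenstein property (`generatesNormalBasis_of_sq_eq`).
-/

/-! ### Units of the integral group ring of the cyclic group of order three -/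

/-- The circulant equations `a * b = 1` in `ℤ[C₃]` have only the solutions with `a = ± g`, `g ∈ C₃`.
The augmentation and the norm form `x² + y² + z² - xy - yz - zx` (the norm from `ℤ[ζ₃]`) are both
multiplicative, so they take the values `±1` and `1` at `a`. -/
theorem groupRing_cyclicThree_unit {a₀ a₁ a₂ b₀ b₁ b₂ : ℤ}
    (h₀ : a₀ * b₀ + a₁ * b₂ + a₂ * b₁ = 1)
    (h₁ : a₀ * b₁ + a₁ * b₀ + a₂ * b₂ = 0)
    (h₂ : a₀ * b₂ + a₁ * b₁ + a₂ * b₀ = 0) :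
    ∃ e : ℤ, (e = 1 ∨ e = -1) ∧
      ((a₀ = e ∧ a₁ = 0 ∧ a₂ = 0) ∨ (a₀ = 0 ∧ a₁ = e ∧ a₂ = 0) ∨
        (a₀ = 0 ∧ a₁ = 0 ∧ a₂ = e)) := by
  have hs : (a₀ + a₁ + a₂) * (b₀ + b₁ + b₂) = 1 := by linear_combination h₀ + h₁ + h₂
  have hN : (a₀ ^ 2 + a₁ ^ 2 + a₂ ^ 2 - a₀ * a₁ - a₁ * a₂ - a₂ * a₀) *
      (b₀ ^ 2 + b₁ ^ 2 + b₂ ^ 2 - b₀ * b₁ - b₁ * b₂ - b₂ * b₀) = 1 := by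
    have key : ∀ x y z : ℤ, x = 1 → y = 0 → z = 0 →
        x ^ 2 + y ^ 2 + z ^ 2 - x * y - y * z - z * x = 1 := by
      rintro _ _ _ rfl rfl rfl; norm_num
    rw [← key _ _ _ h₀ h₁ h₂]
    ring
  have hN1 : a₀ ^ 2 + a₁ ^ 2 + a₂ ^ 2 - a₀ * a₁ - a₁ * a₂ - a₂ * a₀ = 1 := by
    rcases Int.eq_one_or_neg_one_of_mul_eq_one hN with h | h
    · exact h
    · nlinarith [sq_nonneg (a₀ - a₁), sq_nonneg (a₁ - a₂), sq_nonneg (a₂ - a₀)]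
  have hd₁ : (a₀ - a₁) ^ 2 ≤ 1 := by nlinarith [sq_nonneg (a₀ + a₁ - 2 * a₂)]
  have hd₂ : (a₁ - a₂) ^ 2 ≤ 1 := by nlinarith [sq_nonneg (a₁ + a₂ - 2 * a₀)]
  obtain ⟨d, rfl⟩ : ∃ d, a₁ = a₂ + d := ⟨a₁ - a₂, by ring⟩
  obtain ⟨f, rfl⟩ : ∃ f, a₀ = a₂ + d + f := ⟨a₀ - (a₂ + d), by ring⟩
  -- Successive coordinates differ by at most one, and the coordinate sum is `±1`.
  have hf1 : -1 ≤ f := by nlinarith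
  have hf2 : f ≤ 1 := by nlinarith
  have hd1 : -1 ≤ d := by nlinarith
  have hd2 : d ≤ 1 := by nlinarith
  clear h₀ h₁ h₂ hN hd₁ hd₂
  rcases Int.eq_one_or_neg_one_of_mul_eq_one hs with h | h
  · refine ⟨1, Or.inl rfl, ?_⟩
    interval_cases f <;> interval_cases d <;> omega
  · refine ⟨-1, Or.inr rfl, ?_⟩
    interval_cases f <;> interval_cases d <;> omega

/-! ### Cyclic cubic extensions -/

section CyclicCubic

variable {K : Type*} [Field K] [Algebra ℚ K] {σ : K ≃ₐ[ℚ] K}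

theorem isIntegral_int_algEquiv (σ : K ≃ₐ[ℚ] K) {x : K} (hx : IsIntegral ℤ x) :
    IsIntegral ℤ (σ x) :=
  hx.map (σ.toRingEquiv.toRingHom.toIntAlgHom)

theorem apply_apply_apply_of_orderOf_eq_three (h3 : orderOf σ = 3) (x : K) :
    σ (σ (σ x)) = x := by
  have h : σ ^ 3 = 1 := h3 ▸ pow_orderOf_eq_one σ
  have := congrArg (fun τ : K ≃ₐ[ℚ] K => τ x) h
  simpa [pow_succ] using this

/-- An enumeration of the Galois group by the powers of the generator. -/
noncomputable def finThreeEquivAut (hgen : ∀ τ : K ≃ₐ[ℚ] K, τ ∈ Subgroup.zpowers σ)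
    (h3 : orderOf σ = 3) : Fin 3 ≃ (K ≃ₐ[ℚ] K) :=
  (finCongr h3.symm).trans <|
    (finEquivZPowers (orderOf_pos_iff.mp (by omega))).trans
      ((Equiv.subtypeUnivEquiv hgen))

theorem finThreeEquivAut_apply (hgen : ∀ τ : K ≃ₐ[ℚ] K, τ ∈ Subgroup.zpowers σ)
    (h3 : orderOf σ = 3) (i : Fin 3) : finThreeEquivAut hgen h3 i = σ ^ (i : ℕ) := by
  simp [finThreeEquivAut, finEquivZPowers_apply]

theorem range_aut_apply (hgen : ∀ τ : K ≃ₐ[ℚ] K, τ ∈ Subgroup.zpowers σ)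
    (h3 : orderOf σ = 3) (x : K) :
    Set.range (fun τ : K ≃ₐ[ℚ] K => τ x) = {x, σ x, σ (σ x)} := by
  rw [← (finThreeEquivAut hgen h3).surjective.range_comp]
  ext y
  simp only [Set.mem_range, Function.comp, finThreeEquivAut_apply, Fin.exists_fin_succ,
    Set.mem_insert_iff, Set.mem_singleton_iff]
  simp [pow_succ, eq_comm]

theorem isGalois_of_generator [FiniteDimensional ℚ K]
    (hgen : ∀ τ : K ≃ₐ[ℚ] K, τ ∈ Subgroup.zpowers σ)
    (h3 : orderOf σ = 3) (hdim : Module.finrank ℚ K = 3) : IsGalois ℚ K := by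
  apply IsGalois.of_card_aut_eq_finrank
  rw [hdim, ← Nat.card_congr (finThreeEquivAut hgen h3)]
  simp

/-- An algebraic integer fixed by the Galois group is a rational integer. -/
theorem exists_int_of_fixed [FiniteDimensional ℚ K] [IsGalois ℚ K]
    (hgen : ∀ τ : K ≃ₐ[ℚ] K, τ ∈ Subgroup.zpowers σ) {x : K} (hx : IsIntegral ℤ x)
    (hfix : σ x = x) : ∃ z : ℤ, x = z := by
  have hmem : x ∈ (⊥ : IntermediateField ℚ K) := by
    rw [IsGalois.mem_bot_iff_fixed]
    intro τ
    have hσ : σ ∈ MulAction.stabilizer (K ≃ₐ[ℚ] K) x := hfix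
    exact (Subgroup.zpowers_le.mpr hσ) (hgen τ)
  obtain ⟨q, rfl⟩ := IntermediateField.mem_bot.mp hmem
  rw [isIntegral_algebraMap_iff (algebraMap ℚ K).injective] at hx
  obtain ⟨z, rfl⟩ := IsIntegrallyClosed.isIntegral_iff.mp hx
  exact ⟨z, by simp⟩

theorem exists_int_trace [FiniteDimensional ℚ K] [IsGalois ℚ K]
    (hgen : ∀ τ : K ≃ₐ[ℚ] K, τ ∈ Subgroup.zpowers σ) (h3 : orderOf σ = 3) {x : K}
    (hx : IsIntegral ℤ x) : ∃ z : ℤ, x + σ x + σ (σ x) = z := by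
  have hx1 := isIntegral_int_algEquiv σ hx
  refine exists_int_of_fixed hgen ((hx.add hx1).add (isIntegral_int_algEquiv σ hx1)) ?_
  simp only [map_add, apply_apply_apply_of_orderOf_eq_three h3]
  ring

/-- An integer quotient `a / m` that is an algebraic integer is a rational integer. -/
theorem int_dvd_of_isIntegral [CharZero K] {a m : ℤ} {x : K} (hm : m ≠ 0)
    (hx : IsIntegral ℤ x) (h : (m : K) * x = a) : m ∣ a := by
  have hmK : (m : K) ≠ 0 := by exact_mod_cast hm
  have hxq : x = algebraMap ℚ K (a / m) := by
    rw [map_div₀, map_intCast, map_intCast, ← h]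
    field_simp
  rw [hxq, isIntegral_algebraMap_iff (algebraMap ℚ K).injective] at hx
  obtain ⟨z, hz⟩ := IsIntegrallyClosed.isIntegral_iff.mp hx
  have hmQ : (m : ℚ) ≠ 0 := by exact_mod_cast hm
  refine ⟨z, ?_⟩
  have : (a : ℚ) = m * z := by
    rw [eq_div_iff hmQ] at hz
    simpa [mul_comm] using hz.symm
  exact_mod_cast this

/-! ### Normal integral bases in terms of coordinates -/

/-- `α` is an algebraic integer whose conjugates `α, σ α, σ² α` form a `ℤ`-basis of the algebraic
integers of `K`, written out in coordinates. -/
structure GeneratesNormalBasis (σ : K ≃ₐ[ℚ] K) (α : K) : Prop where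
  isIntegral : IsIntegral ℤ α
  span : ∀ β : K, IsIntegral ℤ β → ∃ a b c : ℤ, β = a * α + b * σ α + c * σ (σ α)
  indep : ∀ a b c : ℤ, a * α + b * σ α + c * σ (σ α) = 0 → a = 0 ∧ b = 0 ∧ c = 0

theorem isNormalIntegralBasis_iff [CharZero K]
    (hgen : ∀ τ : K ≃ₐ[ℚ] K, τ ∈ Subgroup.zpowers σ)
    (h3 : orderOf σ = 3) (B : Set K) :
    IsNormalIntegralBasis B ↔ ∃ α, GeneratesNormalBasis σ α ∧ B = {α, σ α, σ (σ α)} := by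
  have e := finThreeEquivAut_apply hgen h3
  constructor
  · rintro ⟨α, b, hb, rfl⟩
    let b' := b.reindex (finThreeEquivAut hgen h3).symm
    have hb' : ∀ i : Fin 3, ((b' i : 𝓞 K) : K) = (σ ^ (i : ℕ)) (α : K) := by
      intro i
      simp [b', hb, e]
    have hb'sum : ∀ a : Fin 3 → ℤ, ((∑ i, a i • b' i : 𝓞 K) : K) =
        a 0 * α + a 1 * σ α + a 2 * σ (σ α) := by
      intro a
      simp [Fin.sum_univ_three, hb', pow_succ]
    refine ⟨α, ⟨α.2, fun β hβ => ?_, fun x y z h => ?_⟩, range_aut_apply hgen h3 _⟩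
    · let β' : 𝓞 K := ⟨β, hβ⟩
      refine ⟨b'.repr β' 0, b'.repr β' 1, b'.repr β' 2, ?_⟩
      rw [← hb'sum, b'.sum_repr]
      rfl
    · have hsum : ∑ i, ![x, y, z] i • b' i = 0 := by
        apply NumberField.RingOfIntegers.ext
        rw [hb'sum]
        simpa using h
      have := Fintype.linearIndependent_iff.mp b'.linearIndependent _ hsum
      exact ⟨this 0, this 1, this 2⟩
  · rintro ⟨α, hα, rfl⟩
    have h1 := isIntegral_int_algEquiv σ hα.isIntegral
    have lift : ∀ x : K, IsIntegral ℤ x → ∃ w : 𝓞 K, (w : K) = x := fun x hx => ⟨⟨x, hx⟩, rfl⟩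
    obtain ⟨w₀, hw₀⟩ := lift _ hα.isIntegral
    obtain ⟨w₁, hw₁⟩ := lift _ h1
    obtain ⟨w₂, hw₂⟩ := lift _ (isIntegral_int_algEquiv σ h1)
    have hvsum : ∀ a : Fin 3 → ℤ, ((∑ i, a i • ![w₀, w₁, w₂] i : 𝓞 K) : K) =
        a 0 * α + a 1 * σ α + a 2 * σ (σ α) := by
      intro a
      simp [Fin.sum_univ_three, hw₀, hw₁, hw₂]
    have hli : LinearIndependent ℤ ![w₀, w₁, w₂] := by
      rw [Fintype.linearIndependent_iff]
      intro g hg i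
      have := hα.indep (g 0) (g 1) (g 2) (by rw [← hvsum, hg]; simp)
      fin_cases i
      exacts [this.1, this.2.1, this.2.2]
    have hsp : ⊤ ≤ Submodule.span ℤ (Set.range ![w₀, w₁, w₂]) := by
      intro β _
      obtain ⟨x, y, z, h⟩ := hα.span β β.2
      rw [Submodule.mem_span_range_iff_exists_fun]
      refine ⟨![x, y, z], ?_⟩
      apply NumberField.RingOfIntegers.ext
      rw [hvsum]
      simpa using h.symm
    refine ⟨w₀, (Module.Basis.mk hli hsp).reindex (finThreeEquivAut hgen h3), fun τ => ?_, ?_⟩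
    · obtain ⟨i, rfl⟩ := (finThreeEquivAut hgen h3).surjective τ
      rw [Module.Basis.reindex_apply, Equiv.symm_apply_apply, Module.Basis.mk_apply, e]
      fin_cases i <;> simp [hw₀, hw₁, hw₂, pow_succ]
    · rw [range_aut_apply hgen h3, hw₀]

theorem GeneratesNormalBasis.neg {α : K} (h : GeneratesNormalBasis σ α) :
    GeneratesNormalBasis σ (-α) where
  isIntegral := h.isIntegral.neg
  span β hβ := by
    obtain ⟨a, b, c, e⟩ := h.span β hβ
    exact ⟨-a, -b, -c, by rw [e]; push_cast; simp only [map_neg]; ring⟩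
  indep a b c e := by
    refine h.indep a b c ?_
    simp only [map_neg] at e
    linear_combination -e

/-- Two generators of normal integral bases differ by a unit of `ℤ[C₃]`, so one is, up to sign,
a conjugate of the other. -/
theorem GeneratesNormalBasis.eq_conj_or_neg [CharZero K] (h3 : orderOf σ = 3) {α β : K}
    (hα : GeneratesNormalBasis σ α) (hβ : GeneratesNormalBasis σ β) :
    ∃ e : ℤ, (e = 1 ∨ e = -1) ∧ (β = e * α ∨ β = e * σ α ∨ β = e * σ (σ α)) := by
  obtain ⟨a₀, a₁, a₂, ha⟩ := hα.span β hβ.isIntegral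
  obtain ⟨b₀, b₁, b₂, hb⟩ := hβ.span α hα.isIntegral
  have hσ := apply_apply_apply_of_orderOf_eq_three h3
  have ha1 := congrArg σ ha
  have ha2 := congrArg σ ha1
  simp only [map_add, map_mul, map_intCast, hσ] at ha1 ha2
  have key := hα.indep (a₀ * b₀ + a₁ * b₂ + a₂ * b₁ - 1) (a₀ * b₁ + a₁ * b₀ + a₂ * b₂)
    (a₀ * b₂ + a₁ * b₁ + a₂ * b₀) (by
      push_cast
      linear_combination -hb - (b₀ : K) * ha - (b₁ : K) * ha1 - (b₂ : K) * ha2)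
  obtain ⟨e, he, h⟩ := groupRing_cyclicThree_unit (sub_eq_zero.mp key.1) key.2.1 key.2.2
  refine ⟨e, he, ?_⟩
  rcases h with ⟨rfl, rfl, rfl⟩ | ⟨rfl, rfl, rfl⟩ | ⟨rfl, rfl, rfl⟩
  · left; rw [ha]; simp
  · right; left; rw [ha]; simp
  · right; right; rw [ha]; simp

theorem GeneratesNormalBasis.setOf_isNormalIntegralBasis [CharZero K]
    (hgen : ∀ τ : K ≃ₐ[ℚ] K, τ ∈ Subgroup.zpowers σ) (h3 : orderOf σ = 3) {α : K}
    (hα : GeneratesNormalBasis σ α) :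
    {B : Set K | IsNormalIntegralBasis B} =
      {{α, σ α, σ (σ α)}, {-α, -σ α, -σ (σ α)}} := by
  have hσ := apply_apply_apply_of_orderOf_eq_three h3
  have rot : ∀ x y z : K, ({y, z, x} : Set K) = {x, y, z} := by
    intro x y z
    rw [Set.pair_comm z x, Set.insert_comm y x]
  ext B
  simp only [Set.mem_ofPred_eq, Set.mem_insert_iff, Set.mem_singleton_iff,
    isNormalIntegralBasis_iff hgen h3]
  constructor
  · rintro ⟨β, hβ, rfl⟩
    obtain ⟨e, rfl | rfl, rfl | rfl | rfl⟩ := hα.eq_conj_or_neg h3 hβ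
    · left; simp
    · left; simpa [hσ] using rot _ _ _
    · left; simpa [hσ] using (rot _ _ _).symm
    · right; simp
    · right; simpa [hσ] using rot _ _ _
    · right; simpa [hσ] using (rot _ _ _).symm
  · rintro (rfl | rfl)
    · exact ⟨α, hα, rfl⟩
    · exact ⟨-α, hα.neg, by simp only [map_neg]⟩

end CyclicCubic

/-! ### A maximality criterion of Eisenstein type -/

/-- A prime dividing `m = h² - 3hl + 9l²` and `l` divides `h`, so its square divides `m`. By the
identity `4m = (2h - 3l)² + 27l²` a prime factor of `m` other than `3` that divides `2h - 3l`
divides `l` as well. -/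
theorem isCoprime_of_squarefree_form {h l m : ℤ} (hm : m = h ^ 2 - 3 * h * l + 9 * l ^ 2)
    (hsq : Squarefree m) (h3 : m ≡ 1 [ZMOD 3]) :
    IsCoprime m (27 * l) ∧ IsCoprime m (2 * h - 3 * l) := by
  have hm0 : m ≠ 0 := hsq.ne_zero
  have hm3 : ¬ (3 : ℤ) ∣ m := by
    intro hd
    have h3' : m % 3 = 1 % 3 := h3
    omega
  have hl : ∀ p : ℤ, Prime p → p ∣ m → ¬ p ∣ l := by
    intro p hp hpm hpl
    have hph : p ∣ h := by
      refine hp.dvd_of_dvd_pow (n := 2) ?_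
      have : h ^ 2 = m - l * (9 * l - 3 * h) := by rw [hm]; ring
      rw [this]
      exact dvd_sub hpm (hpl.mul_right _)
    refine hp.not_isUnit (hsq p ?_)
    obtain ⟨x, rfl⟩ := hph
    obtain ⟨y, rfl⟩ := hpl
    exact ⟨x ^ 2 - 3 * x * y + 9 * y ^ 2, by rw [hm]; ring⟩
  have h27 : ∀ p : ℤ, Prime p → p ∣ m → ¬ p ∣ 27 := by
    intro p hp hpm hp27
    have hp3 : p ∣ 3 := hp.dvd_of_dvd_pow (n := 3) (by norm_num; exact hp27)
    exact hm3 (((hp.associated_of_dvd Int.prime_three hp3).dvd_iff_dvd_left).mp hpm)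
  constructor
  · refine isCoprime_of_prime_dvd (fun h => hm0 h.1) fun p hp hpm hpl => ?_
    rcases hp.dvd_or_dvd hpl with hd | hd
    exacts [h27 p hp hpm hd, hl p hp hpm hd]
  · refine isCoprime_of_prime_dvd (fun h => hm0 h.1) fun p hp hpm hpk => ?_
    have : p ∣ 27 * l ^ 2 := by
      have e : 27 * l ^ 2 = 4 * m - (2 * h - 3 * l) * (2 * h - 3 * l) := by rw [hm]; ring
      rw [e]
      exact dvd_sub (hpm.mul_left _) (hpk.mul_right _)
    rcases hp.dvd_or_dvd this with hd | hd
    exacts [h27 p hp hpm hd, hl p hp hpm (hp.dvd_of_dvd_pow hd)]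

/-- Three elements of sum zero, permuted cyclically and with squares given by one linear rule, are
roots of `X³ - 3mX - (2h - 3l)m`. The rule also gives their products, as `2ab = c² - a² - b²`
whenever `a + b + c = 0`. -/
theorem circulant_sq_relations {K : Type*} [Field K] [CharZero K]
    {h l m Y Y₁ Y₂ : K} (hm : m = h ^ 2 - 3 * h * l + 9 * l ^ 2)
    (hsum : Y + Y₁ + Y₂ = 0) (hq : Y ^ 2 = 2 * m + h * Y + 3 * l * Y₁)
    (hq₁ : Y₁ ^ 2 = 2 * m + h * Y₁ + 3 * l * Y₂) (hq₂ : Y₂ ^ 2 = 2 * m + h * Y₂ + 3 * l * Y) :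
    Y * Y₁ + Y₁ * Y₂ + Y₂ * Y = -3 * m ∧ Y ^ 3 = m * (3 * Y + (2 * h - 3 * l)) ∧
      Y * Y₁ * Y₂ = (2 * h - 3 * l) * m := by
  have aux : ∀ a b c : K, a + b + c = 0 → a ^ 2 = 2 * m + h * a + 3 * l * b →
      b ^ 2 = 2 * m + h * b + 3 * l * c → c ^ 2 = 2 * m + h * c + 3 * l * a →
      a * b = -m + (3 * l - h) * a - h * b := by
    intro a b c hs ha hb hc
    obtain rfl : c = -a - b := by linear_combination hs
    linear_combination (1 / 2 : K) * (hc - ha - hb)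
  have h01 := aux _ _ _ hsum hq hq₁ hq₂
  have h12 := aux _ _ _ (by linear_combination hsum) hq₁ hq₂ hq
  have h20 := aux _ _ _ (by linear_combination hsum) hq₂ hq hq₁
  refine ⟨?_, ?_, ?_⟩
  · linear_combination h01 + h12 + h20 + (3 * l - 2 * h) * hsum
  · linear_combination (Y + h) * hq + 3 * l * h01 - Y * hm
  · linear_combination Y₂ * h01 + (3 * l - h) * h20 - h * h12 - h * (3 * l - h) * hsum - Y₂ * hm

section Maximality

variable {K : Type*} [Field K] [Algebra ℚ K] {σ : K ≃ₐ[ℚ] K}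

/-- If `Y, Y₁, Y₂` are algebraic integers with product `k m`, where `m` is square-free and prime
to `k`, then `m` divides `x` as soon as `x Y² / m` and its conjugates are integral: the norm
`x³ k² / m` is an integer. -/
theorem dvd_of_norm_integral [CharZero K] {m k x : ℤ} (hsq : Squarefree m)
    (hk : IsCoprime m k) {Y Y₁ Y₂ z z₁ z₂ : K} (hprod : Y * Y₁ * Y₂ = k * m)
    (hz : IsIntegral ℤ z) (hz₁ : IsIntegral ℤ z₁) (hz₂ : IsIntegral ℤ z₂)
    (e : m * z = x * Y ^ 2) (e₁ : m * z₁ = x * Y₁ ^ 2) (e₂ : m * z₂ = x * Y₂ ^ 2) : m ∣ x := by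
  have hmK : (m : K) ≠ 0 := by exact_mod_cast hsq.ne_zero
  have hd : m ∣ x ^ 3 * k ^ 2 := by
    refine int_dvd_of_isIntegral hsq.ne_zero ((hz.mul hz₁).mul hz₂) ?_
    apply mul_left_cancel₀ (pow_ne_zero 2 hmK)
    calc (m : K) ^ 2 * (m * (z * z₁ * z₂)) = (m * z) * (m * z₁) * (m * z₂) := by ring
      _ = x ^ 3 * (Y * Y₁ * Y₂) ^ 2 := by rw [e, e₁, e₂]; ring
      _ = _ := by rw [hprod]; push_cast; ring
  exact (hsq.dvd_pow_iff_dvd three_ne_zero).mp ((hk.pow_right (n := 2)).dvd_of_dvd_mul_right hd)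

/-- Eisenstein's argument: for an integral `Y` with `Y³ = m (3Y + k)`, where `m` is square-free and
prime to `k`, an element `γ` of `ℤ[Y]` divisible by `m` among the algebraic integers is divisible
by `m` in `ℤ[Y]`. -/
theorem dvd_coeff_of_eisenstein [CharZero K] {m k : ℤ}
    (hsq : Squarefree m) (hk : IsCoprime m k) {Y γ : K} (hY : IsIntegral ℤ Y)
    (hγ : IsIntegral ℤ γ) (hcub : Y ^ 3 = m * (3 * Y + k))
    (hprod : Y * σ Y * σ (σ Y) = k * m) {x y z : ℤ}
    (hxyz : m * γ = x + y * Y + z * Y ^ 2) : m ∣ x ∧ m ∣ y ∧ m ∣ z := by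
  have hmK : (m : K) ≠ 0 := by exact_mod_cast hsq.ne_zero
  have hint : ∀ a : ℤ, IsIntegral ℤ (a : K) := fun a => by
    simpa using isIntegral_algebraMap (R := ℤ) (A := K) (x := a)
  have key : ∀ (w : ℤ) (δ : K), IsIntegral ℤ δ → m * δ = w * Y ^ 2 → m ∣ w := by
    intro w δ hδ e
    have e₁ := congrArg σ e
    have e₂ := congrArg σ e₁
    simp only [map_mul, map_pow, map_intCast] at e₁ e₂
    exact dvd_of_norm_integral hsq hk hprod hδ (isIntegral_int_algEquiv σ hδ)
      (isIntegral_int_algEquiv σ (isIntegral_int_algEquiv σ hδ)) e e₁ e₂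
  have h3Yk : IsIntegral ℤ (3 * Y + k) := by
    simpa using ((hint 3).mul hY).add (hint k)
  obtain ⟨x', rfl⟩ : m ∣ x := by
    refine key x (γ * Y ^ 2 - (y + z * Y) * (3 * Y + k))
      ((hγ.mul (hY.pow 2)).sub (((hint y).add ((hint z).mul hY)).mul h3Yk)) ?_
    linear_combination Y ^ 2 * hxyz + (y + z * Y) * hcub
  obtain ⟨y', rfl⟩ : m ∣ y := by
    refine key y ((γ - x') * Y - z * (3 * Y + k))
      (((hγ.sub (hint x')).mul hY).sub ((hint z).mul h3Yk)) ?_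
    push_cast at hxyz ⊢
    linear_combination Y * hxyz + z * hcub
  refine ⟨dvd_mul_right _ _, dvd_mul_right _ _, ?_⟩
  refine key z (γ - x' - y' * Y) ((hγ.sub (hint x')).sub ((hint y').mul hY)) ?_
  push_cast at hxyz ⊢
  linear_combination hxyz

/-- Let `α` be an algebraic integer of trace `t = ±1` such that `Y = 3α - t` satisfies
`Y² = 2m + hY + 3l σ(Y)`, where `m = h² - 3hl + 9l² ≡ 1 (mod 3)` is square-free. Then the conjugates
of `α` form a `ℤ`-basis of the algebraic integers.

The trace form shows that `m β` lies in the lattice `M` spanned by the conjugates of `α`, for each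
algebraic integer `β`, and that `27 l m β` lies in `ℤ[Y]`. As `Y³ = 3mY + (2h - 3l)m` is of
Eisenstein type at the primes dividing `m`, even `27 l β` lies in `ℤ[Y] ⊆ M`;
since `m` and `27 l` are coprime, `β` lies in `M`. -/
theorem generatesNormalBasis_of_sq_eq [CharZero K] [FiniteDimensional ℚ K] [IsGalois ℚ K]
    (hgen : ∀ τ : K ≃ₐ[ℚ] K, τ ∈ Subgroup.zpowers σ) (h3 : orderOf σ = 3)
    {h l m t : ℤ} (hm : m = h ^ 2 - 3 * h * l + 9 * l ^ 2) (hsq : Squarefree m)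
    (hm3 : m ≡ 1 [ZMOD 3]) (ht : t * t = 1) {α : K} (hα : IsIntegral ℤ α)
    (htr : α + σ α + σ (σ α) = t)
    (hquad : (3 * α - t) ^ 2 = 2 * m + h * (3 * α - t) + 3 * l * (3 * σ α - t)) :
    GeneratesNormalBasis σ α := by
  obtain ⟨hcop, hk⟩ := isCoprime_of_squarefree_form hm hsq hm3
  have hσ := apply_apply_apply_of_orderOf_eq_three h3
  have hmK0 : (m : K) ≠ 0 := by exact_mod_cast hsq.ne_zero
  have hint : ∀ a : ℤ, IsIntegral ℤ (a : K) := fun a => by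
    simpa using isIntegral_algebraMap (R := ℤ) (A := K) (x := a)
  have hα1 := isIntegral_int_algEquiv σ hα
  have hα2 := isIntegral_int_algEquiv σ hα1
  have hmK : (m : K) = h ^ 2 - 3 * h * l + 9 * l ^ 2 := by rw [hm]; push_cast; ring
  have htK : (t : K) * t = 1 := by exact_mod_cast ht
  have hquad1 := congrArg σ hquad
  have hquad2 := congrArg σ hquad1
  simp only [map_add, map_mul, map_pow, map_sub, map_intCast, map_ofNat, hσ] at hquad1 hquad2
  obtain ⟨g, hg⟩ : ∃ g, m = 1 - 3 * g := by
    have h3' : m % 3 = 1 % 3 := hm3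
    exact ⟨(1 - m) / 3, by omega⟩
  have hgK : (m : K) = 1 - 3 * g := by rw [hg]; push_cast; ring
  have hY : IsIntegral ℤ (3 * α - t) := by
    simpa using ((hint 3).mul hα).sub (hint t)
  obtain ⟨he2, hcub, hprod⟩ := circulant_sq_relations hmK
    (by linear_combination 3 * htr) hquad hquad1 hquad2
  -- The entries of the Gram matrix of the trace form on the conjugates of `α`.
  have hg1 : α * σ α + σ α * σ (σ α) + σ (σ α) * α = g := by
    have h9 : (9 : K) ≠ 0 := by norm_num
    apply mul_left_cancel₀ h9
    linear_combination he2 + 6 * t * htr + 3 * htK - 3 * hgK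
  have hg0 : α ^ 2 + σ α ^ 2 + σ (σ α) ^ 2 = m + g := by
    linear_combination (α + σ α + σ (σ α) + t) * htr - 2 * hg1 + htK - hgK
  refine ⟨hα, fun β hβ => ?_, fun a b c habc => ?_⟩
  · obtain ⟨T, hT⟩ := exists_int_trace hgen h3 hβ
    obtain ⟨T₀, hT₀⟩ := exists_int_trace hgen h3 (hβ.mul hα)
    obtain ⟨T₁, hT₁⟩ := exists_int_trace hgen h3 (hβ.mul hα1)
    obtain ⟨T₂, hT₂⟩ := exists_int_trace hgen h3 (hβ.mul hα2)
    simp only [map_mul, hσ] at hT₀ hT₁ hT₂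
    obtain ⟨A₀, hA₀⟩ : ∃ A, A = T₀ - g * t * T := ⟨_, rfl⟩
    obtain ⟨A₁, hA₁⟩ : ∃ A, A = T₁ - g * t * T := ⟨_, rfl⟩
    obtain ⟨A₂, hA₂⟩ : ∃ A, A = T₂ - g * t * T := ⟨_, rfl⟩
    -- The dual basis of the conjugates for the trace form has denominator `m`.
    have hmβ : (m : K) * β = A₀ * α + A₁ * σ α + A₂ * σ (σ α) := by
      rw [hA₀, hA₁, hA₂]
      push_cast
      rw [← hT, ← hT₀, ← hT₁, ← hT₂]
      linear_combination (-β) * hg0 - (σ β + σ (σ β)) * hg1 +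
        g * (β + σ β + σ (σ β)) * (t * htr + htK)
    -- Here `σ(Y)` is eliminated by means of `3l σ(Y) = Y² - 2m - hY`.
    have hxyz : (m : K) * (27 * l * β) =
        (9 * l * t * (A₀ + A₁ + A₂) - 6 * m * (A₁ - A₂) : ℤ) +
          (9 * l * (A₀ - A₂) - 3 * h * (A₁ - A₂) : ℤ) * (3 * α - t) +
          (3 * (A₁ - A₂) : ℤ) * (3 * α - t) ^ 2 := by
      push_cast
      linear_combination 27 * l * hmβ - 3 * (A₁ - A₂) * hquad + 27 * l * A₂ * htr
    obtain ⟨⟨x, hx⟩, ⟨y, hy⟩, ⟨z, hz⟩⟩ := dvd_coeff_of_eisenstein (k := 2 * h - 3 * l) hsq hk hY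
      (by simpa using ((hint (27 * l)).mul hβ)) (by exact_mod_cast hcub)
      (by simp only [map_sub, map_mul, map_intCast, map_ofNat]; exact_mod_cast hprod) hxyz
    have hlβ : 27 * l * β = x + y * (3 * α - t) + z * (3 * α - t) ^ 2 := by
      apply mul_left_cancel₀ hmK0
      rw [hxyz, hx, hy, hz]
      push_cast
      ring
    obtain ⟨u, v, huv⟩ := hcop
    have huvK : (u : K) * m + v * (27 * l) = 1 := by exact_mod_cast huv
    -- `27 l β = X + P α + Q σ(α)`, and `1 = t (α + σ(α) + σ²(α))`.
    obtain ⟨X, hX⟩ : ∃ X, X = x - t * y + z * (2 * m - h * t - 3 * l * t) := ⟨_, rfl⟩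
    have hXK : (X : K) = x - t * y + z * (2 * m - h * t - 3 * l * t) := by
      rw [hX]; push_cast; ring
    refine ⟨u * A₀ + v * (3 * y + 3 * h * z + X * t), u * A₁ + v * (9 * l * z + X * t),
      u * A₂ + v * (X * t), ?_⟩
    push_cast
    linear_combination (-β) * huvK + u * hmβ + v * hlβ + v * z * hquad - v * hXK
      - v * X * (t * htr + htK)
  · have e₁ := congrArg σ habc
    have e₂ := congrArg σ e₁
    simp only [map_add, map_mul, map_intCast, map_zero, hσ] at e₁ e₂
    -- The trace of the relation gives `a + b + c = 0`; pairing it with the conjugates of `α` under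
    -- the trace form then gives `m a = m b = m c = 0`.
    have hs : (a : K) + b + c = 0 := by
      linear_combination t * (habc + e₁ + e₂) - (a + b + c) * (t * htr + htK)
    have fin : ∀ x : ℤ, (m : K) * x = 0 → x = 0 := by
      intro x hx
      exact_mod_cast (mul_eq_zero.mp hx).resolve_left hmK0
    refine ⟨fin a ?_, fin b ?_, fin c ?_⟩
    · linear_combination α * habc + σ α * e₁ + σ (σ α) * e₂ - a * hg0 - (b + c) * hg1 - g * hs
    · linear_combination σ α * habc + σ (σ α) * e₁ + α * e₂ - b * hg0 - (a + c) * hg1 - g * hs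
    · linear_combination σ (σ α) * habc + α * e₁ + σ α * e₂ - c * hg0 - (a + b) * hg1 - g * hs

end Maximality

/-! ### The simplest cubic fields -/

theorem shanksPoly_monic (n : ℤ) : (shanksPoly n).Monic := by
  unfold shanksPoly
  monicity!

theorem shanksPoly_natDegree (n : ℤ) : (shanksPoly n).natDegree = 3 := by
  unfold shanksPoly
  compute_degree!

/-- A root would be a unit, that is `±1`, but the values there are `-2n - 3` and `1`. -/
theorem shanksPoly_irreducible (n : ℤ) : Irreducible (shanksPoly n) := by
  rw [(shanksPoly_monic n).irreducible_iff_roots_eq_zero_of_degree_le_three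
    (by rw [shanksPoly_natDegree]; norm_num) (by rw [shanksPoly_natDegree])]
  rw [Multiset.eq_zero_iff_forall_notMem]
  intro r hr
  have h : r ^ 3 - n * r ^ 2 - (n + 3) * r - 1 = 0 := by
    simpa [shanksPoly, IsRoot] using isRoot_of_mem_roots hr
  have hu : r * (r ^ 2 - n * r - (n + 3)) = 1 := by linear_combination h
  rcases Int.eq_one_or_neg_one_of_mul_eq_one hu with rfl | rfl
  · ring_nf at h
    omega
  · ring_nf at h
    omega

variable {n : ℤ} {ρ : ℂ}

theorem minpoly_eq_shanksPoly (hρ : aeval ρ (shanksPoly n) = 0) :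
    minpoly ℚ ρ = (shanksPoly n).map (algebraMap ℤ ℚ) := by
  symm
  apply minpoly.eq_of_irreducible_of_monic
  · exact ((shanksPoly_monic n).irreducible_iff_irreducible_map_fraction_map).mp
      (shanksPoly_irreducible n)
  · rw [aeval_map_algebraMap, hρ]
  · exact (shanksPoly_monic n).map _

theorem isIntegral_of_shanksPoly (hρ : aeval ρ (shanksPoly n) = 0) : IsIntegral ℤ ρ :=
  ⟨shanksPoly n, shanksPoly_monic n, hρ⟩

theorem finrank_simplestCubicField (hρ : aeval ρ (shanksPoly n) = 0) :
    Module.finrank ℚ (simplestCubicField ρ) = 3 := by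
  rw [IntermediateField.adjoin.finrank (isIntegral_of_shanksPoly hρ).tower_top,
    minpoly_eq_shanksPoly hρ, (shanksPoly_monic n).natDegree_map, shanksPoly_natDegree]

theorem aeval_shanksPoly {A : Type*} [CommRing A] (n : ℤ) (x : A) :
    aeval x (shanksPoly n) = x ^ 3 - n * x ^ 2 - (n + 3) * x - 1 := by
  simp [shanksPoly, map_ofNat (aeval x) 3]

theorem rootElt_cubic (hρ : aeval ρ (shanksPoly n) = 0) :
    rootElt ρ ^ 3 - n * rootElt ρ ^ 2 - (n + 3) * rootElt ρ - 1 = 0 := by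
  rw [aeval_shanksPoly] at hρ
  apply (simplestCubicField ρ).val.injective
  simp only [map_sub, map_mul, map_pow, map_add, map_intCast, map_ofNat, map_one, map_zero]
  exact hρ

theorem isIntegral_rootElt (hρ : aeval ρ (shanksPoly n) = 0) : IsIntegral ℤ (rootElt ρ) :=
  ⟨shanksPoly n, shanksPoly_monic n, by
    rw [← aeval_def, aeval_shanksPoly, rootElt_cubic hρ]⟩

theorem rootElt_ne_ratCast (hρ : aeval ρ (shanksPoly n) = 0) (q : ℚ) : rootElt ρ ≠ q := by
  intro h
  have hq : algebraMap ℚ ℂ q = ρ := by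
    simpa [rootElt] using (congrArg Subtype.val h).symm
  have := minpoly.eq_X_sub_C ℂ q
  rw [hq, minpoly_eq_shanksPoly hρ] at this
  have h3 := congrArg natDegree this
  rw [(shanksPoly_monic n).natDegree_map, shanksPoly_natDegree, natDegree_X_sub_C] at h3
  omega

theorem one_add_rootElt_ne_zero (hρ : aeval ρ (shanksPoly n) = 0) : 1 + rootElt ρ ≠ 0 := fun h =>
  rootElt_ne_ratCast hρ (-1) (by push_cast; linear_combination h)

/-- The automorphism `ρ ↦ -1 / (1 + ρ)` of the simplest cubic field, with the image of `ρ` written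
as a polynomial in `ρ`. It exists because `(1 + X)³ f_n(-1 / (1 + X)) = -f_n(X)`. -/
theorem exists_algEquiv_rootElt (hρ : aeval ρ (shanksPoly n) = 0) :
    ∃ σ : simplestCubicField ρ ≃ₐ[ℚ] simplestCubicField ρ,
      σ (rootElt ρ) = rootElt ρ ^ 2 - (n + 1) * rootElt ρ - 2 := by
  have hint : IsIntegral ℚ ρ := (isIntegral_of_shanksPoly hρ).tower_top
  have : FiniteDimensional ℚ (simplestCubicField ρ) :=
    IntermediateField.adjoin.finiteDimensional hint
  have hc := rootElt_cubic hρ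
  obtain ⟨θ, hθ⟩ : ∃ θ, θ = rootElt ρ ^ 2 - (n + 1) * rootElt ρ - 2 := ⟨_, rfl⟩
  have hroot : aeval θ (minpoly ℚ ρ) = 0 := by
    rw [minpoly_eq_shanksPoly hρ, aeval_map_algebraMap, aeval_shanksPoly]
    have hu : (1 + rootElt ρ) * θ = -1 := by rw [hθ]; linear_combination hc
    apply mul_left_cancel₀ (pow_ne_zero 3 (one_add_rootElt_ne_zero hρ))
    generalize rootElt ρ = r at hc hu
    calc (1 + r) ^ 3 * (θ ^ 3 - n * θ ^ 2 - (n + 3) * θ - 1)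
        = ((1 + r) * θ) ^ 3 - n * ((1 + r) * θ) ^ 2 * (1 + r)
          - (n + 3) * ((1 + r) * θ) * (1 + r) ^ 2 - (1 + r) ^ 3 := by ring
      _ = (1 + r) ^ 3 * 0 := by rw [hu]; linear_combination -hc
  have hroot' : θ ∈ (minpoly ℚ ρ).aroots (simplestCubicField ρ) :=
    (mem_aroots).mpr ⟨minpoly.ne_zero hint, hroot⟩
  let f := (IntermediateField.algHomAdjoinIntegralEquiv ℚ hint).symm ⟨θ, hroot'⟩
  have hf : f (rootElt ρ) = θ :=
    IntermediateField.algHomAdjoinIntegralEquiv_symm_apply_gen ℚ hint ⟨θ, hroot'⟩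
  exact ⟨AlgEquiv.ofBijective f (Algebra.IsAlgebraic.algHom_bijective f), hf.trans hθ⟩

theorem algEquiv_ext_rootElt {σ τ : simplestCubicField ρ ≃ₐ[ℚ] simplestCubicField ρ}
    (h : σ (rootElt ρ) = τ (rootElt ρ)) : σ = τ := by
  have : (σ : simplestCubicField ρ →ₐ[ℚ] simplestCubicField ρ) = τ := by
    refine IntermediateField.algHom_ext_of_eq_adjoin ℚ (S := simplestCubicField ρ) rfl ?_
    intro x hx
    obtain rfl := Set.mem_singleton_iff.mp hx
    exact h
  exact AlgEquiv.coe_toAlgHom_injective this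

theorem exists_generator (hρ : aeval ρ (shanksPoly n) = 0) :
    ∃ σ : simplestCubicField ρ ≃ₐ[ℚ] simplestCubicField ρ,
      (∀ τ : simplestCubicField ρ ≃ₐ[ℚ] simplestCubicField ρ, τ ∈ Subgroup.zpowers σ) ∧
      orderOf σ = 3 ∧ σ (rootElt ρ) = rootElt ρ ^ 2 - (n + 1) * rootElt ρ - 2 := by
  have hc := rootElt_cubic hρ
  have : FiniteDimensional ℚ (simplestCubicField ρ) :=
    Module.finite_of_finrank_pos (by rw [finrank_simplestCubicField hρ]; norm_num)
  obtain ⟨σ, hσ⟩ := exists_algEquiv_rootElt hρ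
  have h3 : orderOf σ = 3 := by
    apply orderOf_eq_prime
    · apply algEquiv_ext_rootElt
      simp only [pow_succ, pow_zero, one_mul, AlgEquiv.mul_apply, AlgEquiv.one_apply]
      have e : ∀ x : simplestCubicField ρ, (1 + x) * σ x = -1 →
          (1 + σ x) * σ (σ x) = -1 := fun x hx => by simpa using congrArg σ hx
      have e1 : (1 + rootElt ρ) * σ (rootElt ρ) = -1 := by rw [hσ]; linear_combination hc
      have e2 := e _ e1
      have e3 := e _ e2
      generalize σ (σ (σ (rootElt ρ))) = r₃ at e3 ⊢
      generalize σ (σ (rootElt ρ)) = r₂ at e2 e3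
      generalize σ (rootElt ρ) = r₁ at e1 e2
      generalize rootElt ρ = r at e1 ⊢
      have hne : 1 + r₂ ≠ 0 := fun h0 => by rw [h0, zero_mul] at e3; norm_num at e3
      apply mul_left_cancel₀ hne
      linear_combination e3 + r₂ * e1 - (1 + r) * e2
    · intro h1
      rw [h1, AlgEquiv.one_apply] at hσ
      refine rootElt_ne_ratCast hρ (n / 3) ?_
      -- If `σ` fixes `ρ`, then `ρ² + ρ + 1 = 0`, and `n - 3ρ` is the remainder of `f_n` modulo
      -- `X² + X + 1`.
      have hr : rootElt ρ ^ 2 + rootElt ρ + 1 = 0 := by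
        linear_combination (1 + rootElt ρ) * hσ + hc
      push_cast
      linear_combination (-1 / 3 : simplestCubicField ρ) * hc +
        (1 / 3 : simplestCubicField ρ) * (rootElt ρ - (n + 1)) * hr
  refine ⟨σ, ?_, h3, hσ⟩
  have htop : Subgroup.zpowers σ = ⊤ := by
    apply Subgroup.eq_top_of_le_card
    rw [Nat.card_zpowers, h3, ← finrank_simplestCubicField hρ, Nat.card_eq_fintype_card]
    exact AlgEquiv.card_le
  exact fun τ => htop ▸ Subgroup.mem_top τ

/-- For `3 ∤ n` the rational number `v_n` is an integer, and the trace `3 v_n + n` is `±1`. -/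
theorem exists_int_shanksV (hn : ¬ (3 : ℤ) ∣ n) :
    ∃ v t : ℤ, shanksV n = v ∧ 3 * v + n = t ∧ t * t = 1 := by
  have hn' : ((n : ℤ) : ZMod 3) ≠ 0 := by
    rwa [Ne, ZMod.intCast_zmod_eq_zero_iff_dvd]
  have hmod : ((legendreSym 3 n : ℤ) : ZMod 3) = (n : ZMod 3) := by
    simpa using legendreSym.eq_pow 3 n
  obtain ⟨v, hv⟩ := (ZMod.intCast_eq_intCast_iff_dvd_sub _ _ 3).mp hmod.symm
  have hv' : legendreSym 3 n - n = 3 * v := hv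
  refine ⟨v, legendreSym 3 n, ?_, by linarith, ?_⟩
  · have : (legendreSym 3 n : ℚ) - n = 3 * v := by exact_mod_cast hv'
    rw [shanksV, this]
    ring
  · rw [← sq]
    exact legendreSym.sq_one 3 hn'

section Generators

variable {σ : simplestCubicField ρ ≃ₐ[ℚ] simplestCubicField ρ}

/-- Multiplication table of the conjugates, from `ρ₁ (1 + ρ) = -1` and its conjugates. -/
theorem conj_relations (hρ : aeval ρ (shanksPoly n) = 0)
    (hσ : σ (rootElt ρ) = rootElt ρ ^ 2 - (n + 1) * rootElt ρ - 2) :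
    rootElt ρ + σ (rootElt ρ) + σ (σ (rootElt ρ)) = n ∧
      σ (σ (rootElt ρ)) = σ (rootElt ρ) ^ 2 - (n + 1) * σ (rootElt ρ) - 2 ∧
      (1 + rootElt ρ) * σ (rootElt ρ) = -1 := by
  have hc := rootElt_cubic hρ
  have h1 := congrArg σ hσ
  simp only [map_sub, map_mul, map_pow, map_add, map_intCast, map_ofNat, map_one] at h1
  have hm : (1 + rootElt ρ) * σ (rootElt ρ) = -1 := by rw [hσ]; linear_combination hc
  refine ⟨?_, h1, hm⟩
  rw [h1]
  linear_combination σ (rootElt ρ) * hσ + (rootElt ρ - (n + 2)) * hm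

/-- For `α = v_n + ρ` the element `3α - t` is `3ρ - n`, and the quadratic relation of
`generatesNormalBasis_of_sq_eq` holds with `h = n + 3`, `l = 1`, `m = Δ_n`. -/
theorem generatesNormalBasis_of_not_three_dvd (hρ : aeval ρ (shanksPoly n) = 0)
    (hgen : ∀ τ : simplestCubicField ρ ≃ₐ[ℚ] simplestCubicField ρ, τ ∈ Subgroup.zpowers σ)
    (h3 : orderOf σ = 3)
    (hσ : σ (rootElt ρ) = rootElt ρ ^ 2 - (n + 1) * rootElt ρ - 2)
    (hn : ¬ (3 : ℤ) ∣ n) (hsq : Squarefree (shanksDelta n)) :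
    GeneratesNormalBasis σ ((shanksV n : simplestCubicField ρ) + rootElt ρ) := by
  have : FiniteDimensional ℚ (simplestCubicField ρ) :=
    Module.finite_of_finrank_pos (by rw [finrank_simplestCubicField hρ]; norm_num)
  have := isGalois_of_generator hgen h3 (finrank_simplestCubicField hρ)
  obtain ⟨v, t, hv, hvt, ht⟩ := exists_int_shanksV hn
  obtain ⟨htr, h1, hm⟩ := conj_relations hρ hσ
  have htK : (3 * v + n : simplestCubicField ρ) = t := by exact_mod_cast hvt
  rw [hv, Rat.cast_intCast]
  refine generatesNormalBasis_of_sq_eq (h := n + 3) (l := 1) (m := shanksDelta n) (t := t) hgen h3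
    (by unfold shanksDelta; ring) hsq ?_ ht ?_ ?_ ?_
  · have : n % 3 = 1 ∨ n % 3 = 2 := by omega
    unfold shanksDelta
    rcases this with h | h <;> simp [Int.ModEq, pow_two, Int.add_emod, Int.mul_emod, h]
  · have hv : IsIntegral ℤ (v : simplestCubicField ρ) := by
      simpa using isIntegral_algebraMap (R := ℤ) (A := simplestCubicField ρ) (x := v)
    exact hv.add (isIntegral_rootElt hρ)
  · simp only [map_add, map_intCast]
    linear_combination htr + htK
  · simp only [map_add, map_intCast, shanksDelta]
    rw [← htK]
    push_cast
    linear_combination -9 * hσ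

/-- For `n = 12 + 27j` and `α = (ρ - ρ₁ + 3) / 9` the element `3α - 1` is `(ρ - ρ₁) / 3`, and the
quadratic relation of `generatesNormalBasis_of_sq_eq` holds with `h = 1 + 3j`, `l = 1 + 2j`,
`m = Δ_n / 27`. -/
theorem generatesNormalBasis_of_modEq_twelve (hρ : aeval ρ (shanksPoly n) = 0)
    (hgen : ∀ τ : simplestCubicField ρ ≃ₐ[ℚ] simplestCubicField ρ, τ ∈ Subgroup.zpowers σ)
    (h3 : orderOf σ = 3)
    (hσ : σ (rootElt ρ) = rootElt ρ ^ 2 - (n + 1) * rootElt ρ - 2)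
    (hn : n ≡ 12 [ZMOD 27]) (hsq : Squarefree (shanksDelta n / 27)) :
    GeneratesNormalBasis σ ((1 / 9) * (rootElt ρ - σ (rootElt ρ) + 3)) := by
  have : FiniteDimensional ℚ (simplestCubicField ρ) :=
    Module.finite_of_finrank_pos (by rw [finrank_simplestCubicField hρ]; norm_num)
  have := isGalois_of_generator hgen h3 (finrank_simplestCubicField hρ)
  obtain ⟨j, rfl⟩ : ∃ j, n = 12 + 27 * j := by
    have hn' : n % 27 = 12 % 27 := hn
    exact ⟨n / 27, by omega⟩
  obtain ⟨m, hmdef⟩ : ∃ m, m = 7 + 27 * j + 27 * j ^ 2 := ⟨_, rfl⟩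
  have hm : shanksDelta (12 + 27 * j) / 27 = m := by
    have : shanksDelta (12 + 27 * j) = 27 * m := by
      rw [hmdef, shanksDelta]; ring
    omega
  rw [hm] at hsq
  obtain ⟨htr, h1, hmul⟩ := conj_relations hρ hσ
  have hmK : (m : simplestCubicField ρ) = 7 + 27 * j + 27 * j ^ 2 := by
    rw [hmdef]; push_cast; ring
  have hσ3 := apply_apply_apply_of_orderOf_eq_three h3
  obtain ⟨α, hα⟩ : ∃ α, α = (1 / 9) * (rootElt ρ - σ (rootElt ρ) + 3) := ⟨_, rfl⟩
  rw [← hα]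
  have hα1 := congrArg σ hα
  have hα2 := congrArg σ hα1
  simp only [map_sub, map_mul, map_add, map_div₀, map_ofNat, map_one, hσ3] at hα1 hα2
  have htrα : α + σ α + σ (σ α) = (1 : ℤ) := by
    rw [hα2, hα1, hα]
    push_cast
    ring
  have hquad : (3 * α - (1 : ℤ)) ^ 2 = 2 * m + (1 + 3 * j : ℤ) * (3 * α - (1 : ℤ)) +
      3 * (1 + 2 * j : ℤ) * (3 * σ α - (1 : ℤ)) := by
    rw [hα1, hα]
    push_cast at hσ h1 htr ⊢
    linear_combination (1 / 9 : simplestCubicField ρ) * (-hσ - h1 - 2 * hmul) +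
      (1 / 9 : simplestCubicField ρ) * (10 + 18 * j) * htr - 2 * hmK
  refine generatesNormalBasis_of_sq_eq (h := 1 + 3 * j) (l := 1 + 2 * j) (m := m) (t := 1) hgen h3
    (by rw [hmdef]; ring) hsq ?_ rfl ?_ htrα hquad
  · exact (Int.modEq_iff_dvd.mpr ⟨2 + 9 * j + 9 * j ^ 2, by rw [hmdef]; ring⟩ :
      1 ≡ m [ZMOD 3]).symm
  · -- `α` is a root of `X³ - X² - (2 + 9j + 9j²) X + (1 + 2j)²`.
    have hquad1 := congrArg σ hquad
    have hquad2 := congrArg σ hquad1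
    simp only [map_add, map_mul, map_pow, map_sub, map_intCast, map_ofNat, hσ3] at hquad1 hquad2
    obtain ⟨-, hcub, -⟩ := circulant_sq_relations (by rw [hmK]; push_cast; ring)
      (by push_cast at htrα ⊢; linear_combination 3 * htrα) hquad hquad1 hquad2
    refine ⟨X ^ 3 - X ^ 2 - C (2 + 9 * j + 9 * j ^ 2) * X + C ((1 + 2 * j) ^ 2),
      by monicity!, ?_⟩
    rw [← aeval_def]
    simp only [map_add, map_sub, map_mul, map_pow, aeval_X, eq_intCast, map_intCast, map_ofNat,
      map_one]
    push_cast at hcub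
    rw [hmK] at hcub
    linear_combination (1 / 27 : simplestCubicField ρ) * hcub

end Generators

/-- The equation `σ(ρ) = -1 / (1 + ρ)` determines `σ`, and so fixes the numbering of the conjugates.
In part (2) the integer division is exact, as `27 ∣ Δ_n` when `n ≡ 12 (mod 27)`. -/
theorem mainTheorem8 (n : ℤ) (ρ : ℂ) (hρ : aeval ρ (shanksPoly n) = 0) :
    ∃ σ : simplestCubicField ρ ≃ₐ[ℚ] simplestCubicField ρ,
      (∀ τ : simplestCubicField ρ ≃ₐ[ℚ] simplestCubicField ρ, τ ∈ Subgroup.zpowers σ) ∧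
      orderOf σ = 3 ∧
      σ (rootElt ρ) = -1 / (1 + rootElt ρ) ∧
      (¬ (3 : ℤ) ∣ n → Squarefree (shanksDelta n) →
        {B : Set (simplestCubicField ρ) | IsNormalIntegralBasis B} =
          { {(shanksV n : simplestCubicField ρ) + conjRoot σ 0,
              (shanksV n : simplestCubicField ρ) + conjRoot σ 1,
              (shanksV n : simplestCubicField ρ) + conjRoot σ 2},
            {-(shanksV n : simplestCubicField ρ) - conjRoot σ 0,
              -(shanksV n : simplestCubicField ρ) - conjRoot σ 1,
              -(shanksV n : simplestCubicField ρ) - conjRoot σ 2} }) ∧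
      (n ≡ 12 [ZMOD 27] → Squarefree (shanksDelta n / 27) →
        {B : Set (simplestCubicField ρ) | IsNormalIntegralBasis B} =
          { {(1 / 9) * (conjRoot σ 0 - conjRoot σ 1 + 3),
              (1 / 9) * (conjRoot σ 1 - conjRoot σ 2 + 3),
              (1 / 9) * (conjRoot σ 2 - conjRoot σ 0 + 3)},
            {-((1 / 9) * (conjRoot σ 0 - conjRoot σ 1 + 3)),
              -((1 / 9) * (conjRoot σ 1 - conjRoot σ 2 + 3)),
              -((1 / 9) * (conjRoot σ 2 - conjRoot σ 0 + 3))} }) := by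
  obtain ⟨σ, hgen, h3, hσ⟩ := exists_generator hρ
  have hσ3 := apply_apply_apply_of_orderOf_eq_three h3 (rootElt ρ)
  have c0 : conjRoot σ 0 = rootElt ρ := by simp [conjRoot]
  have c1 : conjRoot σ 1 = σ (rootElt ρ) := by simp [conjRoot]
  have c2 : conjRoot σ 2 = σ (σ (rootElt ρ)) := by simp [conjRoot, pow_two]
  refine ⟨σ, hgen, h3, ?_, fun hn hsq => ?_, fun hn hsq => ?_⟩
  · rw [eq_div_iff (one_add_rootElt_ne_zero hρ), mul_comm]
    exact (conj_relations hρ hσ).2.2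
  · rw [(generatesNormalBasis_of_not_three_dvd hρ hgen h3 hσ hn hsq).setOf_isNormalIntegralBasis
      hgen h3, c0, c1, c2]
    simp only [map_add, map_ratCast, neg_add']
  · rw [(generatesNormalBasis_of_modEq_twelve hρ hgen h3 hσ hn hsq).setOf_isNormalIntegralBasis
      hgen h3, c0, c1, c2]
    simp only [map_add, map_sub, map_mul, map_div₀, map_ofNat, map_one, hσ3]
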